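/- Let $d\ge 1$ and let $X_1,X_2,\dots$ be independent random points in $\mathbb R^d$, each with the standard Gaussian distribution, i.e. with density $\varphi(x)=(2\pi)^{-d/2}\exp(-\|x\|^2/2)$. For $n\ge 0$ let $P_n$ be the convex hull of $X_1,\dots,X_n$ (so $P_0=\emptyset$), and let $f_{d-1}(P_n)$ be the number of its $(d-1)$-dimensional faces, where a face of $P_n$ is a nonempty set of the form $\{x\in P_n : \ell(x)=\max_{P_n}\ell\}$ with $\ell$ a linear functional on $\mathbb R^d$ ($\ell=0$ is allowed, so a polytope of dimension $d-1$ counts as its own $(d-1)$-dimensional face). Then $f_{d-1}(P_n)$ is integrable for every $n$, and the expected number of facets is nondecreasing in $n$: $$\mathbb E f_{d-1}(P_n)\le \mathbb E f_{d-1}(P_{n+1})\qquad\text{for all } n\ge 0 .$$ -/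

import Mathlib

open MeasureTheory ProbabilityTheory

/-- The set of `j`-dimensional faces of a convex set `P`: the nonempty sets of points of `P` at
which some linear functional attains its maximum over `P` (the zero functional gives `P` itself),
whose affine hull has dimension `j`. -/
def polytopeFaces {E : Type*} [NormedAddCommGroup E] [NormedSpace ℝ E] (j : ℕ) (P : Set E) :
    Set (Set E) :=
  {F | F.Nonempty ∧ IsExposed ℝ P F ∧ Module.finrank ℝ (vectorSpan ℝ F) = j}

/-- A polytope has only finitely many faces, so that counting them with `Set.ncard` is honest. -/
theorem finite_polytopeFaces {E : Type*} [NormedAddCommGroup E] [NormedSpace ℝ E]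
    (j : ℕ) {S : Set E} (hS : S.Finite) : (polytopeFaces j (convexHull ℝ S)).Finite := by
  refine Set.Finite.of_finite_image (f := fun F => F ∩ S) ?_ ?_
  · exact hS.finite_subsets.subset (by rintro _ ⟨F, -, rfl⟩; exact Set.inter_subset_right)
  · have hP : IsCompact (convexHull ℝ S) := hS.isCompact_convexHull (𝕜 := ℝ)
    have key : ∀ F ∈ polytopeFaces j (convexHull ℝ S), F = convexHull ℝ (F ∩ S) := by
      rintro F ⟨-, hF, -⟩
      have hconv : Convex ℝ F := hF.convex (convex_convexHull ℝ S)
      have hcomp : IsCompact F := hF.isCompact hP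
      refine Set.Subset.antisymm ?_ (convexHull_min Set.inter_subset_left hconv)
      have hext : F.extremePoints ℝ ⊆ F ∩ S := fun x hx =>
        ⟨hx.1, extremePoints_convexHull_subset (hF.isExtreme.extremePoints_subset_extremePoints hx)⟩
      calc F = closure (convexHull ℝ (F.extremePoints ℝ)) :=
            (closure_convexHull_extremePoints hcomp hconv).symm
        _ ⊆ closure (convexHull ℝ (F ∩ S)) := closure_mono (convexHull_mono hext)
        _ = convexHull ℝ (F ∩ S) :=
            ((hS.subset Set.inter_subset_right).isCompact_convexHull (𝕜 := ℝ)).isClosed.closure_eq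
    intro F hF G hG h
    rw [key F hF, key G hG]
    exact congrArg _ h

/-- `f_j(P)`, the number of `j`-dimensional faces of the polytope `P`. -/
noncomputable def faceNumber {E : Type*} [NormedAddCommGroup E] [NormedSpace ℝ E] (j : ℕ)
    (P : Set E) : ℕ :=
  (polytopeFaces j P).ncard

/-- The convex hull `P_n` of the first `n` points of the sequence `x`. -/
def pointHull {E : Type*} [NormedAddCommGroup E] [NormedSpace ℝ E] (x : ℕ → E) (n : ℕ) : Set E :=
  convexHull ℝ (x '' {i | i < n})

/-!
Almost surely any `d + 1` of the points are affinely independent (`ae_affineIndependent`). In this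
general position the facets of `P_n` correspond to the `d`-subsets of the points for which all other
points lie strictly on one side of the hyperplane through the subset
(`faceNumber_pointHull_eq_card`, `isFacetSet_iff`). The expected number of facets is thus
`n.choose d` times the probability of this event for one subset.

A normal vector of the hyperplane through `d` points is a determinant in their differences
(`crossNormal`). For Gaussian points the differences are independent of the sum
(`indepFun_sub_sum`). Hence the normal direction may be treated as fixed, and the signed distance `h`
of the hyperplane from the origin, which is the component of the mean in that direction, has law
`N(0, 1 / d)`. A further point lies beyond the hyperplane with probability `1 - Φ(h)`, where `Φ` is
the standard normal distribution function. So for `n > d` the expected number of facets is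
`2 * n.choose d * ∫ (1 - Φ) ^ (n - d) ∂N(0, 1 / d)` (`integrable_and_integral_faceNumber`); it is
`1` for `n = d` and `0` for `n < d`.

The density of `N(0, 1 / d)` is proportional to `φ ^ d`, where `φ = Φ'`. An integration by parts
reduces the monotonicity in `n` to the pointwise inequality `φ x + x * Φ x ≥ 0`
(`gaussianPDFReal_add_mul_cdf_nonneg`, `choose_mul_integral_one_sub_cdf_pow_le`).
-/

/-! ### Facets of the convex hull of points in general position -/

/-- The points `x i`, `i ∈ S`, span a supporting hyperplane `{ℓ = c}` that contains none of the
other points among `x 0, …, x (n - 1)`, all of which lie on the side `{ℓ < c}`. If `S` is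
nonempty, the functional can be zero only if there are no other points. -/
def IsFacetSet {E : Type*} [NormedAddCommGroup E] [NormedSpace ℝ E] (x : ℕ → E) (n : ℕ)
    (S : Finset ℕ) : Prop :=
  ∃ (l : StrongDual ℝ E) (c : ℝ), (∀ i ∈ S, l (x i) = c) ∧ ∀ j ∈ Finset.range n \ S, l (x j) < c

section Geometry

variable {E : Type*} [NormedAddCommGroup E] [NormedSpace ℝ E]

/-- A face of a polytope is the convex hull of the generating points that it contains, by the
Krein–Milman theorem. -/
theorem IsExposed.eq_convexHull_inter {S F : Set E} (hS : S.Finite)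
    (hF : IsExposed ℝ (convexHull ℝ S) F) : F = convexHull ℝ (F ∩ S) := by
  have hP : IsCompact (convexHull ℝ S) := hS.isCompact_convexHull (𝕜 := ℝ)
  have hconv : Convex ℝ F := hF.convex (convex_convexHull ℝ S)
  have hcomp : IsCompact F := hF.isCompact hP
  refine Set.Subset.antisymm ?_ (convexHull_min Set.inter_subset_left hconv)
  have hext : F.extremePoints ℝ ⊆ F ∩ S := fun x hx =>
    ⟨hx.1, extremePoints_convexHull_subset (hF.isExtreme.extremePoints_subset_extremePoints hx)⟩
  calc F = closure (convexHull ℝ (F.extremePoints ℝ)) :=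
        (closure_convexHull_extremePoints hcomp hconv).symm
    _ ⊆ closure (convexHull ℝ (F ∩ S)) := closure_mono (convexHull_mono hext)
    _ = convexHull ℝ (F ∩ S) :=
        ((hS.subset Set.inter_subset_right).isCompact_convexHull (𝕜 := ℝ)).isClosed.closure_eq

theorem vectorSpan_convexHull (S : Set E) : vectorSpan ℝ (convexHull ℝ S) = vectorSpan ℝ S := by
  rw [← direction_affineSpan, affineSpan_convexHull, direction_affineSpan]

theorem le_of_mem_convexHull {S : Set E} {l : StrongDual ℝ E} {c : ℝ} (h : ∀ p ∈ S, l p ≤ c)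
    {p : E} (hp : p ∈ convexHull ℝ S) : l p ≤ c :=
  convexHull_min (t := {p | l p ≤ c}) h
    (convex_halfSpace_le l.toLinearMap.isLinear c) hp

theorem eq_of_mem_convexHull {S : Set E} {l : StrongDual ℝ E} {c : ℝ} (h : ∀ p ∈ S, l p = c)
    {p : E} (hp : p ∈ convexHull ℝ S) : l p = c :=
  convexHull_min (t := {p | l p = c}) h
    (convex_hyperplane l.toLinearMap.isLinear c) hp

theorem convexHull_image_mem_polytopeFaces {x : ℕ → E} {n k : ℕ} {S : Finset ℕ}
    (hSn : S ⊆ Finset.range n) (hcard : S.card = k + 1)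
    (hindep : AffineIndependent ℝ (fun i : S => x i)) (hS : IsFacetSet x n S) :
    convexHull ℝ (x '' S) ∈ polytopeFaces k (pointHull x n) := by
  classical
  obtain ⟨l, c, hl, hl'⟩ := hS
  have hne : S.Nonempty := Finset.card_pos.1 (by omega)
  obtain ⟨s, hs⟩ := hne
  have hfin : (x '' {i | i < n}).Finite := (Set.finite_lt_nat n).image x
  have hle : ∀ p ∈ pointHull x n, l p ≤ c := by
    intro p hp
    refine le_of_mem_convexHull ?_ hp
    rintro _ ⟨i, hi, rfl⟩
    by_cases his : i ∈ S
    · exact (hl i his).le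
    · exact (hl' i (by simp_all)).le
  have hsP : x s ∈ pointHull x n :=
    subset_convexHull ℝ _ ⟨s, by simpa using hSn hs, rfl⟩
  set G : Set E := {p ∈ pointHull x n | ∀ y ∈ pointHull x n, l y ≤ l p} with hG
  have hGexp : IsExposed ℝ (pointHull x n) G := fun _ => ⟨l, rfl⟩
  have hGx : G ∩ x '' {i | i < n} = x '' S := by
    ext p
    constructor
    · rintro ⟨hp, i, hi, rfl⟩
      refine ⟨i, ?_, rfl⟩
      by_contra his
      have h1 := hl' i (by simp_all)
      have h2 := hp.2 _ hsP
      rw [hl s hs] at h2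
      exact absurd h1 h2.not_gt
    · rintro ⟨i, hi, rfl⟩
      have hin : i < n := by simpa using hSn hi
      refine ⟨⟨subset_convexHull ℝ _ ⟨i, hin, rfl⟩, fun y hy => ?_⟩, i, hin, rfl⟩
      rw [hl i hi]; exact hle y hy
  have hGS : G = convexHull ℝ (x '' S) := by
    rw [← hGx]; exact hGexp.eq_convexHull_inter hfin
  refine ⟨⟨x s, subset_convexHull ℝ _ ⟨s, hs, rfl⟩⟩, hGS ▸ hGexp, ?_⟩
  rw [vectorSpan_convexHull]
  have h := hindep.finrank_vectorSpan (n := k) (by simpa using hcard)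
  rwa [show Set.range (fun i : S => x i) = x '' S by ext; simp] at h

/-- A face of dimension `k` contains at least `k + 1` of the points, and in general position no
`k + 2` of them, since these would span a larger dimension. -/
theorem exists_facetSet_of_mem_polytopeFaces {x : ℕ → E} {n k : ℕ}
    (hgen : ∀ S ⊆ Finset.range n, S.card ≤ k + 2 → AffineIndependent ℝ (fun i : S => x i))
    {F : Set E} (hF : F ∈ polytopeFaces k (pointHull x n)) :
    ∃ S ⊆ Finset.range n, S.card = k + 1 ∧ IsFacetSet x n S ∧ convexHull ℝ (x '' S) = F := by
  classical
  obtain ⟨hne, hexp, hdim⟩ := hF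
  have hfin : (x '' {i | i < n}).Finite := (Set.finite_lt_nat n).image x
  set S : Finset ℕ := (Finset.range n).filter (fun i => x i ∈ F) with hS
  have hSx : F ∩ x '' {i | i < n} = x '' S := by
    ext p
    constructor
    · rintro ⟨hp, i, hi, rfl⟩
      exact ⟨i, by simp_all, rfl⟩
    · rintro ⟨i, hi, rfl⟩
      simp only [hS, Finset.coe_filter, Finset.mem_range, Set.mem_ofPred_eq] at hi
      exact ⟨hi.2, i, hi.1, rfl⟩
  have hFS : F = convexHull ℝ (x '' S) := by
    rw [← hSx]; exact hexp.eq_convexHull_inter hfin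
  have hSn : S ⊆ Finset.range n := Finset.filter_subset _ _
  have hdim' : Module.finrank ℝ (vectorSpan ℝ (x '' S)) = k := by
    rw [← vectorSpan_convexHull, ← hFS, hdim]
  have hSne : S.Nonempty := by
    rw [hFS, convexHull_nonempty_iff, Set.image_nonempty] at hne
    exact_mod_cast hne
  -- fewer points span less than `k` dimensions
  have h1 : k + 1 ≤ S.card := by
    obtain ⟨m, hm⟩ : ∃ m, S.card = m + 1 := ⟨S.card - 1, by have := hSne.card_pos; omega⟩
    have := finrank_vectorSpan_image_finset_le ℝ x S hm
    rw [Finset.coe_image, hdim'] at this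
    omega
  have h2 : S.card ≤ k + 1 := by
    by_contra hcon
    obtain ⟨T, hTS, hT⟩ := Finset.exists_subset_card_eq (s := S) (n := k + 2) (by omega)
    have h := (hgen T (hTS.trans hSn) hT.le).finrank_vectorSpan (n := k + 1) (by simpa using hT)
    rw [show Set.range (fun i : T => x i) = x '' T by ext; simp] at h
    have hle : vectorSpan ℝ (x '' T) ≤ vectorSpan ℝ (x '' S) :=
      vectorSpan_mono ℝ (Set.image_mono (by exact_mod_cast hTS))
    have hfd : FiniteDimensional ℝ (vectorSpan ℝ (x '' S)) :=
      finiteDimensional_vectorSpan_of_finite ℝ (S.finite_toSet.image x)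
    have := Submodule.finrank_mono hle
    omega
  refine ⟨S, hSn, by omega, ?_, hFS.symm⟩
  obtain ⟨l, hl⟩ := hexp hne
  obtain ⟨p, hp⟩ := hne
  have hmax : ∀ q ∈ F, l q = l p := fun q hq => by
    rw [hl] at hp hq
    exact le_antisymm (hp.2 _ hq.1) (hq.2 _ hp.1)
  refine ⟨l, l p, fun i hi => hmax _ (by simp [hS] at hi; exact hi.2), fun j hj => ?_⟩
  simp only [hS, Finset.mem_sdiff, Finset.mem_range, Finset.mem_filter, not_and] at hj
  have hjP : x j ∈ pointHull x n := subset_convexHull ℝ _ ⟨j, hj.1, rfl⟩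
  have hjF := hj.2 hj.1
  rw [hl] at hjF hp
  by_contra hlt
  exact hjF ⟨hjP, fun y hy => (hp.2 y hy).trans (not_lt.1 hlt)⟩

/-- A face determines the set of points that it contains. -/
theorem subset_of_convexHull_image_subset {x : ℕ → E} {n : ℕ} {S T : Finset ℕ}
    (hSn : S ⊆ Finset.range n) (hT : IsFacetSet x n T)
    (h : convexHull ℝ (x '' S) ⊆ convexHull ℝ (x '' T)) : S ⊆ T := by
  obtain ⟨l, c, hl, hl'⟩ := hT
  intro i hi
  by_contra hiT
  have h1 : l (x i) = c := eq_of_mem_convexHull (S := x '' T)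
    (by rintro _ ⟨j, hj, rfl⟩; exact hl j hj)
    (h (subset_convexHull ℝ _ ⟨i, hi, rfl⟩))
  exact (hl' i (Finset.mem_sdiff.2 ⟨hSn hi, hiT⟩)).ne h1

open Classical in
/-- For points in general position, the facets correspond to the sets of vertices that they
contain. -/
theorem faceNumber_pointHull_eq_card {x : ℕ → E} {n k : ℕ}
    (hgen : ∀ S ⊆ Finset.range n, S.card ≤ k + 2 → AffineIndependent ℝ (fun i : S => x i)) :
    faceNumber k (pointHull x n) =
      (((Finset.range n).powersetCard (k + 1)).filter (IsFacetSet x n)).card := by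
  have himg : polytopeFaces k (pointHull x n) = (fun S : Finset ℕ => convexHull ℝ (x '' S)) ''
      (((Finset.range n).powersetCard (k + 1)).filter (IsFacetSet x n) : Finset (Finset ℕ)) := by
    ext F
    constructor
    · intro hF
      obtain ⟨S, h1, h2, h3, h4⟩ := exists_facetSet_of_mem_polytopeFaces hgen hF
      exact ⟨S, by simp [h1, h2, h3], h4⟩
    · rintro ⟨S, hS, rfl⟩
      simp only [Finset.coe_filter, Finset.mem_powersetCard, Set.mem_ofPred_eq] at hS
      exact convexHull_image_mem_polytopeFaces hS.1.1 hS.1.2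
        (hgen S hS.1.1 (by omega)) hS.2
  rw [faceNumber, himg, Set.InjOn.ncard_image, Set.ncard_coe_finset]
  intro S hS T hT h
  simp only [Finset.coe_filter, Finset.mem_powersetCard, Set.mem_ofPred_eq] at hS hT
  exact Finset.Subset.antisymm (subset_of_convexHull_image_subset hS.1.1 hT.2 h.subset)
    (subset_of_convexHull_image_subset hT.1.1 hS.2 h.symm.subset)

end Geometry

/-! ### A monotonicity property of Gaussian tail integrals -/

section Calculus

open Filter Topology Set

local notation "φ" => gaussianPDFReal 0 1
local notation "Φ" => cdf (gaussianReal 0 1)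

theorem gaussianPDFReal_zero_one (x : ℝ) :
    φ x = (√(2 * Real.pi))⁻¹ * Real.exp (-x ^ 2 / 2) := by
  simp [gaussianPDFReal]

theorem hasDerivAt_gaussianPDFReal_zero_one (x : ℝ) : HasDerivAt φ (-x * φ x) x := by
  have h1 : HasDerivAt (fun y : ℝ => -y ^ 2 / 2) (-x) x := by
    refine (((hasDerivAt_pow 2 x).fun_neg).div_const 2).congr_deriv ?_
    push_cast
    ring
  have h2 := (h1.exp).const_mul (√(2 * Real.pi))⁻¹
  rw [show (φ : ℝ → ℝ) = fun y => (√(2 * Real.pi))⁻¹ * Real.exp (-y ^ 2 / 2) from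
    funext gaussianPDFReal_zero_one]
  exact h2.congr_deriv (by ring)

theorem continuous_gaussianPDFReal_zero_one : Continuous φ :=
  continuous_iff_continuousAt.2 fun x => (hasDerivAt_gaussianPDFReal_zero_one x).continuousAt

theorem gaussianPDFReal_zero_one_le_one (x : ℝ) : φ x ≤ 1 := by
  rw [gaussianPDFReal_zero_one]
  refine mul_le_one₀ (inv_le_one_of_one_le₀ ?_) (Real.exp_pos _).le
    (Real.exp_le_one_iff.2 (by nlinarith [sq_nonneg x]))
  rw [Real.one_le_sqrt]
  linarith [Real.pi_gt_three]

theorem integrable_mul_gaussianPDFReal_zero_one : Integrable (fun x => x * φ x) := by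
  have h := (integrable_mul_exp_neg_mul_sq (b := 1 / 2) (by norm_num)).const_mul
    (√(2 * Real.pi))⁻¹
  refine h.congr (ae_of_all _ fun x => ?_)
  simp only [gaussianPDFReal_zero_one]
  rw [show -(1 / 2) * x ^ 2 = -x ^ 2 / 2 by ring]
  ring

theorem integrable_deriv_gaussianPDFReal_zero_one : Integrable (fun x => -x * φ x) := by
  simpa using integrable_mul_gaussianPDFReal_zero_one.neg

theorem tendsto_gaussianPDFReal_atBot : Tendsto φ atBot (𝓝 0) :=
  tendsto_zero_of_hasDerivAt_of_integrableOn_Iic (a := 0)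
    (fun x _ => hasDerivAt_gaussianPDFReal_zero_one x)
    integrable_deriv_gaussianPDFReal_zero_one.integrableOn
    (integrable_gaussianPDFReal 0 1).integrableOn

theorem cdf_gaussianReal_eq_integral (x : ℝ) : Φ x = ∫ t in Iic x, φ t := by
  rw [cdf_eq_real, measureReal_def, gaussianReal_apply_eq_integral _ one_ne_zero,
    ENNReal.toReal_ofReal (integral_nonneg (gaussianPDFReal_nonneg 0 1))]

theorem hasDerivAt_cdf_gaussianReal (x : ℝ) : HasDerivAt Φ (φ x) x := by
  have hint := integrable_gaussianPDFReal 0 1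
  have h1 : (Φ : ℝ → ℝ) = fun y => (∫ t in Iic (0 : ℝ), φ t) + ∫ t in (0 : ℝ)..y, φ t := by
    funext y
    rw [cdf_gaussianReal_eq_integral,
      ← intervalIntegral.integral_Iic_sub_Iic hint.integrableOn hint.integrableOn]
    ring
  rw [h1]
  exact (intervalIntegral.integral_hasDerivAt_right hint.intervalIntegrable
    (stronglyMeasurable_gaussianPDFReal 0 1).stronglyMeasurableAtFilter
    continuous_gaussianPDFReal_zero_one.continuousAt).const_add _

/-- A form of the Mills ratio inequality. The expression equals `∫ t in Iic x, (x - t) * φ t`. -/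
theorem gaussianPDFReal_add_mul_cdf_nonneg (x : ℝ) : 0 ≤ φ x + x * Φ x := by
  have hint := integrable_gaussianPDFReal 0 1
  have h1 : ∫ t in Iic x, -t * φ t = φ x - 0 :=
    integral_Iic_of_hasDerivAt_of_tendsto'
      (fun t _ => hasDerivAt_gaussianPDFReal_zero_one t)
      integrable_deriv_gaussianPDFReal_zero_one.integrableOn tendsto_gaussianPDFReal_atBot
  have h2 : φ x + x * Φ x = ∫ t in Iic x, (-t * φ t + x * φ t) := by
    rw [integral_add integrable_deriv_gaussianPDFReal_zero_one.integrableOn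
      (hint.const_mul x).integrableOn, h1, integral_const_mul,
      cdf_gaussianReal_eq_integral, sub_zero]
  rw [h2]
  refine setIntegral_nonneg measurableSet_Iic fun t ht => ?_
  rw [← add_mul]
  exact mul_nonneg (by linarith [mem_Iic.1 ht]) (gaussianPDFReal_nonneg 0 1 t)

theorem continuous_cdf_gaussianReal : Continuous Φ :=
  continuous_iff_continuousAt.2 fun x => (hasDerivAt_cdf_gaussianReal x).continuousAt

theorem integrable_gaussianPDFReal_pow_mul {f : ℝ → ℝ} (hf : Continuous f) (hf0 : ∀ x, |f x| ≤ 1)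
    (k : ℕ) : Integrable (fun x => f x * φ x ^ (k + 1)) := by
  refine (integrable_gaussianPDFReal 0 1).mono
    (hf.mul (continuous_gaussianPDFReal_zero_one.pow _)).aestronglyMeasurable
    (ae_of_all _ fun x => ?_)
  have h0 := gaussianPDFReal_nonneg 0 1 x
  have h1 := gaussianPDFReal_zero_one_le_one x
  rw [norm_mul, Real.norm_eq_abs, Real.norm_eq_abs, Real.norm_eq_abs, abs_pow, abs_of_nonneg h0]
  calc |f x| * φ x ^ (k + 1) ≤ 1 * φ x ^ (k + 1) := by gcongr; exact hf0 x
    _ ≤ φ x := by rw [one_mul, pow_succ]; exact mul_le_of_le_one_left h0 (pow_le_one₀ h0 h1)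

theorem abs_one_sub_cdf_pow_le_one (m : ℕ) (x : ℝ) : |(1 - Φ x) ^ m| ≤ 1 := by
  have h0 := cdf_nonneg (gaussianReal 0 1) x
  have h1 := cdf_le_one (gaussianReal 0 1) x
  rw [abs_pow]
  exact pow_le_one₀ (abs_nonneg _) (abs_le.2 ⟨by linarith, by linarith⟩)

/-- Write `Q = 1 - Φ`. Up to the derivative of `Q ^ (m + 1) * Φ * φ ^ k`, whose integral vanishes,
the integrand of the difference of the two sides is `k * Q ^ (m + 1) * φ ^ k * (φ + x * Φ)`, which
is nonnegative by `gaussianPDFReal_add_mul_cdf_nonneg`. -/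
theorem succ_mul_integral_one_sub_cdf_pow_mul_le (m k : ℕ) :
    (m + 1) * ∫ x, (1 - Φ x) ^ m * φ x ^ (k + 1) ≤
      (m + k + 2) * ∫ x, (1 - Φ x) ^ (m + 1) * φ x ^ (k + 1) := by
  have hQc (j : ℕ) : Continuous (fun x => (1 - Φ x) ^ j) :=
    (continuous_const.sub continuous_cdf_gaussianReal).pow j
  have hΦ0 := cdf_nonneg (gaussianReal 0 1)
  have hΦ1 := cdf_le_one (gaussianReal 0 1)
  have hφ0 := gaussianPDFReal_nonneg 0 1
  have hΦ (x : ℝ) : |Φ x| ≤ 1 := abs_le.2 ⟨by linarith [hΦ0 x], hΦ1 x⟩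
  have hI (j : ℕ) : Integrable (fun x => (1 - Φ x) ^ j * φ x ^ (k + 1)) :=
    integrable_gaussianPDFReal_pow_mul (hQc j) (abs_one_sub_cdf_pow_le_one j) k
  set F : ℝ → ℝ := fun x => (1 - Φ x) ^ (m + 1) * Φ x * φ x ^ k with hF
  set F' : ℝ → ℝ := fun x => (-(m + 1)) * ((1 - Φ x) ^ m * Φ x * φ x ^ (k + 1)) +
    (1 - Φ x) ^ (m + 1) * φ x ^ (k + 1) +
    k * ((1 - Φ x) ^ (m + 1) * Φ x * φ x ^ (k - 1) * (-x * φ x)) with hF'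
  have hderiv (x : ℝ) : HasDerivAt F (F' x) x := by
    have h1 := ((hasDerivAt_cdf_gaussianReal x).const_sub 1).fun_pow (m + 1)
    have h2 := (hasDerivAt_gaussianPDFReal_zero_one x).fun_pow k
    have h3 := (h1.mul (hasDerivAt_cdf_gaussianReal x)).mul h2
    refine h3.congr_deriv ?_
    simp only [hF', Pi.mul_apply, Nat.add_sub_cancel]
    push_cast
    ring
  have hint : Integrable F' := by
    refine Integrable.add (Integrable.add (Integrable.const_mul ?_ _) (hI (m + 1))) ?_
    · refine integrable_gaussianPDFReal_pow_mul ((hQc m).mul continuous_cdf_gaussianReal) ?_ k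
      intro x
      rw [Pi.mul_apply, abs_mul]
      exact mul_le_one₀ (abs_one_sub_cdf_pow_le_one m x) (abs_nonneg _) (hΦ x)
    · refine Integrable.const_mul ?_ _
      refine integrable_deriv_gaussianPDFReal_zero_one.mono
        (Continuous.aestronglyMeasurable ?_) (ae_of_all _ fun x => ?_)
      · exact (((hQc _).mul continuous_cdf_gaussianReal).mul
          (continuous_gaussianPDFReal_zero_one.pow _)).mul
          (continuous_neg.mul continuous_gaussianPDFReal_zero_one)
      · rw [norm_mul]
        refine mul_le_of_le_one_left (norm_nonneg _) ?_
        rw [Real.norm_eq_abs, abs_mul, abs_mul, abs_pow (φ x), abs_of_nonneg (hφ0 x)]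
        exact mul_le_one₀ (mul_le_one₀ (abs_one_sub_cdf_pow_le_one _ x) (abs_nonneg _) (hΦ x))
          (pow_nonneg (hφ0 x) _) (pow_le_one₀ (hφ0 x) (gaussianPDFReal_zero_one_le_one x))
  have hbound (x : ℝ) : |F x| ≤ |1 - Φ x| ∧ |F x| ≤ |Φ x| := by
    have hp : |φ x ^ k| ≤ 1 := by
      rw [abs_pow, abs_of_nonneg (hφ0 x)]
      exact pow_le_one₀ (hφ0 x) (gaussianPDFReal_zero_one_le_one x)
    have hq := abs_one_sub_cdf_pow_le_one m x
    have hq' := abs_one_sub_cdf_pow_le_one (m + 1) x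
    constructor
    · calc |F x| = |1 - Φ x| * (|(1 - Φ x) ^ m| * |Φ x| * |φ x ^ k|) := by
            simp only [hF, abs_mul, pow_succ]; ring
        _ ≤ _ := mul_le_of_le_one_right (abs_nonneg _)
            (mul_le_one₀ (mul_le_one₀ hq (abs_nonneg _) (hΦ x)) (abs_nonneg _) hp)
    · calc |F x| = |Φ x| * (|(1 - Φ x) ^ (m + 1)| * |φ x ^ k|) := by
            simp only [hF, abs_mul]; ring
        _ ≤ _ := mul_le_of_le_one_right (abs_nonneg _) (mul_le_one₀ hq' (abs_nonneg _) hp)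
  have hbot : Tendsto F atBot (𝓝 0) := by
    refine squeeze_zero_norm (fun x => (hbound x).2) ?_
    simpa using (tendsto_cdf_atBot (gaussianReal 0 1)).abs
  have htop : Tendsto F atTop (𝓝 0) := by
    refine squeeze_zero_norm (fun x => (hbound x).1) ?_
    simpa using ((tendsto_cdf_atTop (gaussianReal 0 1)).const_sub 1).abs
  have hzero : ∫ x, F' x = 0 := by
    simpa using integral_of_hasDerivAt_of_tendsto hderiv hint hbot htop
  have hle : ∫ x, F' x ≤ ∫ x, ((m + k + 2) * ((1 - Φ x) ^ (m + 1) * φ x ^ (k + 1)) -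
      (m + 1) * ((1 - Φ x) ^ m * φ x ^ (k + 1))) := by
    refine integral_mono hint (((hI _).const_mul _).sub ((hI _).const_mul _)) fun x => ?_
    rw [← sub_nonneg]
    have key : 0 ≤ k * ((1 - Φ x) ^ (m + 1) * φ x ^ k * (φ x + x * Φ x)) := by
      refine mul_nonneg k.cast_nonneg (mul_nonneg (mul_nonneg (pow_nonneg ?_ _)
        (pow_nonneg (hφ0 x) _)) (gaussianPDFReal_add_mul_cdf_nonneg x))
      linarith [hΦ1 x]
    refine key.trans_eq ?_
    -- `F'` contains `φ ^ (k - 1)`, which multiplies `k` and hence is harmless for `k = 0`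
    rcases k with _ | k
    · simp only [hF', pow_succ]; push_cast; ring
    · simp only [hF', pow_succ, Nat.add_sub_cancel]; push_cast; ring
  rw [hzero, integral_sub ((hI _).const_mul _) ((hI _).const_mul _), integral_const_mul,
    integral_const_mul] at hle
  linarith

/-- The density of `N(0, 1 / (k + 1))` is proportional to the `(k + 1)`-st power of the standard
normal density. -/
theorem integral_gaussianReal_inv_nat (k : ℕ) :
    ∃ c : ℝ, 0 < c ∧ ∀ f : ℝ → ℝ, ∫ x, f x ∂gaussianReal 0 ((k + 1 : ℕ) : NNReal)⁻¹ =
      c * ∫ x, f x * φ x ^ (k + 1) := by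
  refine ⟨(√(2 * Real.pi * ((k + 1 : ℕ) : NNReal)⁻¹))⁻¹ * √(2 * Real.pi) ^ (k + 1),
    by positivity, fun f => ?_⟩
  rw [integral_gaussianReal_eq_integral_smul (by positivity), ← integral_const_mul]
  refine integral_congr_ae (ae_of_all _ fun x => ?_)
  simp only [smul_eq_mul, gaussianPDFReal_zero_one]
  simp only [gaussianPDFReal, mul_pow, ← Real.exp_nat_mul]
  have h : √(2 * Real.pi) ≠ 0 := by positivity
  have h2 : -(x - 0) ^ 2 / (2 * (((k + 1 : ℕ) : NNReal)⁻¹ : NNReal)) =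
      ((k + 1 : ℕ) : ℝ) * (-x ^ 2 / 2) := by
    push_cast
    field_simp
    ring
  rw [h2, inv_pow]
  field_simp

theorem succ_mul_integral_one_sub_cdf_pow_le (m : ℕ) {d : ℕ} (hd : 1 ≤ d) :
    (m + 1) * ∫ x, (1 - Φ x) ^ m ∂gaussianReal 0 (d : NNReal)⁻¹ ≤
      (m + 1 + d) * ∫ x, (1 - Φ x) ^ (m + 1) ∂gaussianReal 0 (d : NNReal)⁻¹ := by
  obtain ⟨k, rfl⟩ : ∃ k, d = k + 1 := ⟨d - 1, by omega⟩
  obtain ⟨c, hc, h⟩ := integral_gaussianReal_inv_nat k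
  rw [h, h]
  have := mul_le_mul_of_nonneg_left (succ_mul_integral_one_sub_cdf_pow_mul_le m k) hc.le
  push_cast
  linarith

/-- With `n = m + d` and `m ≥ 1`, the quantities compared are half the expected facet numbers
of `n` and of `n + 1` Gaussian points in `ℝ^d`. -/
theorem choose_mul_integral_one_sub_cdf_pow_le (m : ℕ) {d : ℕ} (hd : 1 ≤ d) :
    (m + d).choose d * ∫ x, (1 - Φ x) ^ m ∂gaussianReal 0 (d : NNReal)⁻¹ ≤
      (m + 1 + d).choose d * ∫ x, (1 - Φ x) ^ (m + 1) ∂gaussianReal 0 (d : NNReal)⁻¹ := by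
  have h := succ_mul_integral_one_sub_cdf_pow_le m hd
  have hch : ((m + 1 + d).choose d : ℝ) * (m + 1) = (m + d).choose d * (m + 1 + d) := by
    have := Nat.choose_mul_succ_eq (m + d) d
    rw [show m + d + 1 - d = m + 1 by omega, show m + d + 1 = m + 1 + d by omega] at this
    exact_mod_cast this.symm
  have hm : (0 : ℝ) < m + 1 := by positivity
  refine le_of_mul_le_mul_left ?_ hm
  have := mul_le_mul_of_nonneg_left h ((m + d).choose d).cast_nonneg (α := ℝ)
  calc _ = ((m + d).choose d : ℝ) *
        ((m + 1) * ∫ x, (1 - Φ x) ^ m ∂gaussianReal 0 (d : NNReal)⁻¹) := by ring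
    _ ≤ _ := this
    _ = ((m + d).choose d * (m + 1 + d)) *
        ∫ x, (1 - Φ x) ^ (m + 1) ∂gaussianReal 0 (d : NNReal)⁻¹ := by ring
    _ = _ := by rw [← hch]; ring

end Calculus

/-! ### Gaussian points are in general position -/

section GeneralPosition

variable {E : Type*} [NormedAddCommGroup E] [InnerProductSpace ℝ E] [FiniteDimensional ℝ E]
  [MeasurableSpace E] [BorelSpace E]

theorem map_inner_stdGaussian (u : E) :
    (stdGaussian E).map (fun y => inner ℝ u y) = gaussianReal 0 (‖u‖ ^ 2).toNNReal := by
  have h := IsGaussian.map_eq_gaussianReal (μ := stdGaussian E) (innerSL ℝ u)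
  rw [integral_strongDual_stdGaussian, variance_dual_stdGaussian, innerSL_apply_norm] at h
  exact h

theorem stdGaussian_affineSubspace_eq_zero {A : AffineSubspace ℝ E} (hA : A ≠ ⊤) :
    stdGaussian E (A : Set E) = 0 := by
  rcases A.eq_bot_or_nonempty with rfl | ⟨p, hp⟩
  · simp
  have hperp : A.directionᗮ ≠ ⊥ := by
    rwa [Ne, Submodule.orthogonal_eq_bot_iff,
      AffineSubspace.direction_eq_top_iff_of_nonempty ⟨p, hp⟩]
  obtain ⟨v, hv, hv0⟩ := Submodule.exists_mem_ne_zero_of_ne_bot hperp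
  have hsub : (A : Set E) ⊆ (fun y => inner ℝ v y) ⁻¹' {inner ℝ v p} := by
    intro y hy
    have h := (Submodule.mem_orthogonal' _ _).1 hv _ (AffineSubspace.vsub_mem_direction hy hp)
    rw [vsub_eq_sub, inner_sub_right, sub_eq_zero] at h
    exact h
  refine measure_mono_null hsub ?_
  rw [← Measure.map_apply (by fun_prop) (measurableSet_singleton _), map_inner_stdGaussian]
  have hvar : (‖v‖ ^ 2).toNNReal ≠ 0 := by
    rw [Ne, Real.toNNReal_eq_zero, not_le]
    have := norm_pos_iff.2 hv0
    positivity
  have := nullSingletonClass_gaussianReal (μ := 0) hvar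
  exact measure_singleton _

variable {Ω : Type*} [MeasurableSpace Ω] {μ : Measure Ω} [IsProbabilityMeasure μ]

/-- Up to `dim E + 1` independent Gaussian points are almost surely affinely independent: a new
point almost surely avoids the proper affine subspace spanned by the previous ones. -/
theorem ae_affineIndependent {X : ℕ → Ω → E} (hX : ∀ i, HasLaw (X i) (stdGaussian E) μ)
    (hindep : iIndepFun X μ) (S : Finset ℕ) (hS : S.card ≤ Module.finrank ℝ E + 1) :
    ∀ᵐ ω ∂μ, AffineIndependent ℝ (fun i : S => X i ω) := by
  classical
  induction S using Finset.induction_on with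
  | empty => exact ae_of_all _ fun ω => affineIndependent_of_subsingleton ℝ _
  | insert j S hj ih =>
    rw [Finset.card_insert_of_notMem hj] at hS
    specialize ih (by omega)
    have hmeas : ∀ i, AEMeasurable (X i) μ := fun i => (hX i).aemeasurable
    have hpair : IndepFun (fun ω (i : S) => X i ω) (X j) μ :=
      (hindep.indepFun_finset₀ S {j} (by simpa using hj) hmeas).comp measurable_id
        (measurable_pi_apply (⟨j, by simp⟩ : ({j} : Finset ℕ)))
    have hmS : AEMeasurable (fun ω (i : S) => X i ω) μ := aemeasurable_pi_lambda _ fun i => hmeas i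
    have hlaw := (indepFun_iff_map_prod_eq_prod_map_map hmS (hmeas j)).1 hpair
    set G : Set ((S → E) × E) :=
      {q | AffineIndependent ℝ (fun o : Option S => o.elim q.2 q.1)} with hG
    have hGm : MeasurableSet G := by
      refine IsOpen.measurableSet ?_
      refine (isOpen_setOfPred_affineIndependent (𝕜 := ℝ) (E := E) (ι := Option S)).preimage
        (f := fun q : (S → E) × E => fun o : Option S => o.elim q.2 q.1) ?_
      refine continuous_pi fun o => ?_
      rcases o with _ | i
      · exact continuous_snd
      · exact (continuous_apply i).comp continuous_fst
    have hopen : MeasurableSet {y : S → E | AffineIndependent ℝ y} :=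
      isOpen_setOfPred_affineIndependent.measurableSet
    have hae : ∀ᵐ q ∂μ.map (fun ω => ((fun i : S => X i ω), X j ω)), q ∈ G := by
      rw [hlaw, Measure.ae_prod_iff_ae_ae (p := fun q => q ∈ G) hGm]
      have hih : ∀ᵐ y ∂μ.map (fun ω (i : S) => X i ω), AffineIndependent ℝ y :=
        (ae_map_iff hmS hopen).2 ih
      filter_upwards [hih] with y hy
      have hdir : affineSpan ℝ (Set.range y) ≠ ⊤ := by
        intro htop
        rcases S.eq_empty_or_nonempty with rfl | hne
        · rw [Set.range_eq_empty, AffineSubspace.span_empty] at htop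
          exact AffineSubspace.bot_ne_top ℝ E E htop
        · have h1 : Module.finrank ℝ (vectorSpan ℝ (Set.range y)) = Module.finrank ℝ E := by
            rw [← direction_affineSpan, htop, AffineSubspace.direction_top, finrank_top]
          have := hne.card_pos
          have := finrank_vectorSpan_range_le ℝ y (n := S.card - 1) (by simp; omega)
          omega
      have hnull := stdGaussian_affineSubspace_eq_zero hdir
      rw [(hX j).map_eq]
      filter_upwards [measure_eq_zero_iff_ae_notMem.1 hnull] with z hz
      refine AffineIndependent.affineIndependent_of_notMem_span (i := none) ?_ ?_
      · have := hy.comp_embedding (ι2 := {o : Option S // o ≠ none})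
          ⟨fun o => o.1.get (Option.isSome_iff_ne_none.2 o.2), fun o o' h =>
            Subtype.ext (Option.get_inj.1 h)⟩
        refine (congrArg (AffineIndependent ℝ) ?_).mpr this
        funext ⟨o, ho⟩
        rcases o with _ | i
        · exact absurd rfl ho
        · rfl
      · refine fun hmem => hz (affineSpan_mono ℝ ?_ hmem)
        rintro _ ⟨o, ho, rfl⟩
        rcases o with _ | i
        · exact absurd rfl ho
        · exact ⟨i, rfl⟩
    have hae' := ae_of_ae_map (hmS.prodMk (hmeas j)) hae
    filter_upwards [hae'] with ω hω
    rw [← affineIndependent_equiv (Finset.subtypeInsertEquivOption hj).symm]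
    refine (congrArg (AffineIndependent ℝ) ?_).mpr hω
    funext o
    rcases o with _ | i
    · rfl
    · rfl

end GeneralPosition

/-! ### The one-sidedness probability of a Gaussian hyperplane -/

section Facet

open scoped ENNReal

variable {E : Type*} [NormedAddCommGroup E] [InnerProductSpace ℝ E] [FiniteDimensional ℝ E]
  [MeasurableSpace E] [BorelSpace E]
variable {Ω : Type*} [MeasurableSpace Ω] {μ : Measure Ω}

/-- The differences of independent standard Gaussian vectors are uncorrelated with their sum, hence
independent of it by joint Gaussianity. -/
theorem indepFun_sub_sum [IsProbabilityMeasure μ] {ι : Type*} [Fintype ι] {Y : ι → Ω → E}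
    (hY : ∀ i, HasLaw (Y i) (stdGaussian E) μ) (hindep : iIndepFun Y μ) (i₀ : ι) :
    IndepFun (fun ω i => Y i ω - Y i₀ ω) (fun ω => ∑ i, Y i ω) μ := by
  classical
  have hG : ∀ i, HasGaussianLaw (Y i) μ := fun i => (hY i).hasGaussianLaw
  have hjoint : HasGaussianLaw (fun ω i => Y i ω) μ := hindep.hasGaussianLaw hG
  let L : (ι → E) →L[ℝ] (ι → E) × E :=
    (ContinuousLinearMap.pi fun i =>
      (ContinuousLinearMap.proj (R := ℝ) (φ := fun _ : ι => E) i -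
        ContinuousLinearMap.proj (R := ℝ) (φ := fun _ : ι => E) i₀ : (ι → E) →L[ℝ] E)).prod
      (∑ i, ContinuousLinearMap.proj (R := ℝ) (φ := fun _ : ι => E) i)
  have hpair : HasGaussianLaw (fun ω => ((fun i => Y i ω - Y i₀ ω), ∑ i, Y i ω)) μ := by
    refine (hjoint.map L).congr (ae_of_all _ fun ω => ?_)
    simp [L]
  refine hpair.indepFun_of_covariance_strongDual fun L₁ L₂ => ?_
  have hmem (b : StrongDual ℝ E) (i : ι) : MemLp (fun ω => b (Y i ω)) 2 μ :=
    ((hG i).map b).memLp_two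
  have hcov (b c : StrongDual ℝ E) (i : ι) :
      cov[fun ω => b (Y i ω), fun ω => ∑ k, c (Y k ω); μ] = cov[b, c; stdGaussian E] := by
    rw [covariance_fun_sum_right (hmem c) (hmem b i), Finset.sum_eq_single i]
    · exact (hY i).covariance_fun_comp (by fun_prop) (by fun_prop)
    · intro k _ hk
      exact ((hindep.indepFun hk.symm).comp b.measurable c.measurable).covariance_eq_zero
        (hmem b i) (hmem c k)
    · simp
  have h1 : L₁ ∘ (fun ω i => Y i ω - Y i₀ ω) =
      fun ω => ∑ i, ((L₁ ∘L .single ℝ (fun _ => E) i) (Y i ω) -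
        (L₁ ∘L .single ℝ (fun _ => E) i) (Y i₀ ω)) := by
    funext ω
    rw [Function.comp_apply, ← Finset.univ_sum_single (fun i => Y i ω - Y i₀ ω), map_sum]
    refine Finset.sum_congr rfl fun i _ => ?_
    rw [← map_sub]
    rfl
  have h2 : L₂ ∘ (fun ω => ∑ i, Y i ω) = fun ω => ∑ k, L₂ (Y k ω) := by
    funext ω; simp
  have hdiff (i : ι) : MemLp (fun ω => (L₁ ∘L .single ℝ (fun _ => E) i) (Y i ω) -
      (L₁ ∘L .single ℝ (fun _ => E) i) (Y i₀ ω)) 2 μ := (hmem _ i).sub (hmem _ i₀)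
  rw [h1, h2, covariance_fun_sum_left hdiff (memLp_finsetSum _ fun k _ => hmem L₂ k)]
  refine Finset.sum_eq_zero fun i _ => ?_
  rw [covariance_fun_sub_left (hmem _ i) (hmem _ i₀) (memLp_finsetSum _ fun k _ => hmem L₂ k),
    hcov, hcov, sub_self]

theorem hasLaw_inner_stdGaussian {Y : Ω → E} (hY : HasLaw Y (stdGaussian E) μ) {u : E}
    (hu : ‖u‖ = 1) : HasLaw (fun ω => inner ℝ u (Y ω)) (gaussianReal 0 1) μ := by
  have h : HasLaw (fun y => inner ℝ u y) (gaussianReal 0 1) (stdGaussian E) :=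
    ⟨by fun_prop, by rw [map_inner_stdGaussian]; simp [hu]⟩
  exact h.fun_comp hY

theorem hasLaw_mean_gaussianReal {ι : Type*} [Fintype ι] [Nonempty ι] {Z : ι → Ω → ℝ}
    (hZ : ∀ i, HasLaw (Z i) (gaussianReal 0 1) μ) (hindep : iIndepFun Z μ) :
    HasLaw (fun ω => (Fintype.card ι : ℝ)⁻¹ * ∑ i, Z i ω)
      (gaussianReal 0 (Fintype.card ι : NNReal)⁻¹) μ := by
  have hG : ∀ i, HasGaussianLaw (Z i) μ := fun i => (hZ i).hasGaussianLaw
  have hsum : HasGaussianLaw (fun ω => ∑ i, Z i ω) μ := hindep.hasGaussianLaw_fun_sum hG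
  have hlaw : HasLaw (fun ω => ∑ i, Z i ω) (gaussianReal 0 (Fintype.card ι)) μ := by
    refine ⟨hsum.aemeasurable, ?_⟩
    have := hsum.isGaussian_map
    rw [this.eq_gaussianReal]
    congr 1
    · rw [integral_map hsum.aemeasurable (by fun_prop)]
      simp only [id]
      rw [integral_finsetSum _ fun i _ => (hG i).integrable]
      refine Finset.sum_eq_zero fun i _ => ?_
      rw [(hZ i).integral_eq, integral_id_gaussianReal]
    · rw [variance_map (by fun_prop) hsum.aemeasurable]
      have : Var[id ∘ (fun ω => ∑ i, Z i ω); μ] = Fintype.card ι := by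
        rw [Function.id_comp, show (fun ω => ∑ i, Z i ω) = ∑ i, Z i by ext; simp,
          IndepFun.variance_sum (fun i _ => (hG i).memLp_two)
            (fun i _ j _ hij => hindep.indepFun hij)]
        simp [(hZ _).variance_eq, variance_id_gaussianReal]
      rw [this]; simp
  convert gaussianReal_const_mul hlaw (Fintype.card ι : ℝ)⁻¹ using 2
  · simp
  · ext
    simp
    field_simp

/-- Conditionally on `Y`, the variables `Z j` exceed it independently, each with probability
`1 - Φ(Y)`. -/
theorem measure_forall_lt_of_indepFun [IsProbabilityMeasure μ] {κ : Type*} [Fintype κ]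
    {ν : Measure ℝ} [IsProbabilityMeasure ν] {Y : Ω → ℝ} {Z : κ → Ω → ℝ} (hY : HasLaw Y ν μ)
    (hZ : ∀ j, HasLaw (Z j) (gaussianReal 0 1) μ) (hindep : iIndepFun Z μ)
    (hYZ : IndepFun Y (fun ω j => Z j ω) μ) :
    μ {ω | ∀ j, Y ω < Z j ω} =
      ENNReal.ofReal (∫ y, (1 - cdf (gaussianReal 0 1) y) ^ Fintype.card κ ∂ν) := by
  have hZm : AEMeasurable (fun ω j => Z j ω) μ :=
    aemeasurable_pi_lambda _ fun j => (hZ j).aemeasurable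
  have hlaw := (indepFun_iff_map_prod_eq_prod_map_map hY.aemeasurable hZm).1 hYZ
  rw [(iIndepFun_iff_map_fun_eq_pi_map fun j => (hZ j).aemeasurable).1 hindep, hY.map_eq] at hlaw
  simp only [(hZ _).map_eq] at hlaw
  have hB : MeasurableSet {q : ℝ × (κ → ℝ) | ∀ j, q.1 < q.2 j} := by
    simp only [Set.ofPred_forall]
    exact MeasurableSet.iInter fun j => measurableSet_lt (by fun_prop) (by fun_prop)
  have h1 : μ {ω | ∀ j, Y ω < Z j ω} =
      μ.map (fun ω => (Y ω, fun j => Z j ω)) {q : ℝ × (κ → ℝ) | ∀ j, q.1 < q.2 j} := by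
    rw [Measure.map_apply_of_aemeasurable (hY.aemeasurable.prodMk hZm) hB]
    rfl
  rw [h1, hlaw, Measure.prod_apply hB, ofReal_integral_eq_lintegral_ofReal]
  · refine lintegral_congr fun y => ?_
    have h2 : Prod.mk y ⁻¹' {q : ℝ × (κ → ℝ) | ∀ j, q.1 < q.2 j} =
        Set.univ.pi fun _ : κ => Set.Ioi y := by
      ext z; simp
    rw [h2, Measure.pi_pi, Finset.prod_const, Finset.card_univ,
      ENNReal.ofReal_pow (by linarith [cdf_le_one (gaussianReal 0 1) y])]
    congr 1
    rw [cdf_eq_real, ← probReal_compl_eq_one_sub measurableSet_Iic, Set.compl_Iic,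
      ofReal_measureReal]
  · refine Integrable.of_bound (C := 1)
      ((continuous_const.sub continuous_cdf_gaussianReal).pow _).aestronglyMeasurable
      (ae_of_all _ fun y => ?_)
    exact abs_one_sub_cdf_pow_le_one _ y
  · exact ae_of_all _ fun y => pow_nonneg (by linarith [cdf_le_one (gaussianReal 0 1) y]) _

/-- If `f` is independent of `g` and `(f, g)` of `h`, then `f` is independent of `(g, h)`. -/
theorem IndepFun.prodMk_right {α β γ : Type*} [MeasurableSpace α] [MeasurableSpace β]
    [MeasurableSpace γ] [IsProbabilityMeasure μ] {f : Ω → α} {g : Ω → β} {h : Ω → γ}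
    (hf : AEMeasurable f μ)
    (hg : AEMeasurable g μ) (hh : AEMeasurable h μ) (hfg : IndepFun f g μ)
    (hfgh : IndepFun (fun ω => (f ω, g ω)) h μ) : IndepFun f (fun ω => (g ω, h ω)) μ := by
  have hgh : IndepFun g h μ := hfgh.comp measurable_snd measurable_id
  rw [indepFun_iff_map_prod_eq_prod_map_map hf (hg.prodMk hh),
    (indepFun_iff_map_prod_eq_prod_map_map hg hh).1 hgh]
  have h1 := (indepFun_iff_map_prod_eq_prod_map_map (hf.prodMk hg) hh).1 hfgh
  rw [(indepFun_iff_map_prod_eq_prod_map_map hf hg).1 hfg] at h1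
  have h2 := congrArg (Measure.map MeasurableEquiv.prodAssoc) h1
  rw [AEMeasurable.map_map_of_aemeasurable (by fun_prop) ((hf.prodMk hg).prodMk hh),
    (measurePreserving_prodAssoc _ _ _).map_eq] at h2
  exact h2

/-- The case of a deterministic direction `u`. The event does not depend on the length of `u`, so
that `u` may be taken to be a unit vector. -/
theorem measure_forall_mean_inner_lt [IsProbabilityMeasure μ] {ι κ : Type*} [Fintype ι] [Nonempty ι]
    [Fintype κ] {Y : ι → Ω → E} {W : κ → Ω → E} (hY : ∀ i, HasLaw (Y i) (stdGaussian E) μ)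
    (hW : ∀ j, HasLaw (W j) (stdGaussian E) μ) (hYi : iIndepFun Y μ) (hWi : iIndepFun W μ)
    (hYW : IndepFun (fun ω i => Y i ω) (fun ω j => W j ω) μ) {u : E} (hu : u ≠ 0) :
    μ {ω | ∀ j, (Fintype.card ι : ℝ)⁻¹ * inner ℝ u (∑ i, Y i ω) < inner ℝ u (W j ω)} =
      ENNReal.ofReal (∫ y, (1 - cdf (gaussianReal 0 1) y) ^ Fintype.card κ
        ∂gaussianReal 0 (Fintype.card ι : NNReal)⁻¹) := by
  set v : E := ‖u‖⁻¹ • u with hv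
  have hpos : 0 < ‖u‖⁻¹ := inv_pos.2 (norm_pos_iff.2 hu)
  have hv1 : ‖v‖ = 1 := by
    rw [hv, norm_smul, norm_inv, norm_norm, inv_mul_cancel₀ (norm_ne_zero_iff.2 hu)]
  have hinner : Measurable fun y : E => inner ℝ v y := by fun_prop
  have hYv : iIndepFun (fun i ω => inner ℝ v (Y i ω)) μ :=
    hYi.comp (fun _ y => inner ℝ v y) fun _ => hinner
  have hWv : iIndepFun (fun j ω => inner ℝ v (W j ω)) μ :=
    hWi.comp (fun _ y => inner ℝ v y) fun _ => hinner
  have hYWv : IndepFun (fun ω => (Fintype.card ι : ℝ)⁻¹ * ∑ i, inner ℝ v (Y i ω))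
      (fun ω j => inner ℝ v (W j ω)) μ :=
    hYW.comp (φ := fun y : ι → E => (Fintype.card ι : ℝ)⁻¹ * ∑ i, inner ℝ v (y i))
      (ψ := fun (w : κ → E) j => inner ℝ v (w j)) (by fun_prop) (by fun_prop)
  rw [← measure_forall_lt_of_indepFun
    (hasLaw_mean_gaussianReal (fun i => hasLaw_inner_stdGaussian (hY i) hv1) hYv)
    (fun j => hasLaw_inner_stdGaussian (hW j) hv1) hWv hYWv]
  congr 1
  ext ω
  simp only [Set.mem_ofPred_eq, hv, real_inner_smul_left, ← Finset.mul_sum, ← inner_sum]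
  refine forall_congr' fun j => ?_
  rw [mul_left_comm, mul_lt_mul_iff_right₀ hpos]

/-- Let the direction `u` depend only on the differences of the points `Y i` and be orthogonal to
them. All `Y i` then have the same component along `u`, namely that of their mean, and the mean is
independent of the differences. So `u` can be treated as a deterministic direction. -/
theorem measure_forall_inner_lt [IsProbabilityMeasure μ] {ι κ : Type*} [Fintype ι] [Fintype κ]
    {Y : ι → Ω → E} {W : κ → Ω → E} (hY : ∀ i, HasLaw (Y i) (stdGaussian E) μ)
    (hW : ∀ j, HasLaw (W j) (stdGaussian E) μ) (hYi : iIndepFun Y μ) (hWi : iIndepFun W μ)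
    (hYW : IndepFun (fun ω i => Y i ω) (fun ω j => W j ω) μ) (i₀ : ι)
    {u : (ι → E) → E} (hum : Measurable u)
    (hu : ∀ δ : ι → E, δ i₀ = 0 → ∀ i, inner ℝ (u δ) (δ i) = 0)
    (hu0 : ∀ᵐ ω ∂μ, u (fun i => Y i ω - Y i₀ ω) ≠ 0) :
    μ {ω | ∀ j, inner ℝ (u fun i => Y i ω - Y i₀ ω) (Y i₀ ω) <
        inner ℝ (u fun i => Y i ω - Y i₀ ω) (W j ω)} =
      ENNReal.ofReal (∫ y, (1 - cdf (gaussianReal 0 1) y) ^ Fintype.card κ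
        ∂gaussianReal 0 (Fintype.card ι : NNReal)⁻¹) := by
  have : Nonempty ι := ⟨i₀⟩
  have hmY : AEMeasurable (fun ω i => Y i ω) μ :=
    aemeasurable_pi_lambda _ fun i => (hY i).aemeasurable
  have hmW : AEMeasurable (fun ω j => W j ω) μ :=
    aemeasurable_pi_lambda _ fun j => (hW j).aemeasurable
  set D : Ω → ι → E := fun ω i => Y i ω - Y i₀ ω with hD
  set M : Ω → E := fun ω => ∑ i, Y i ω with hM
  have hmap : Measurable fun y : ι → E => ((fun i => y i - y i₀), ∑ i, y i) := by fun_prop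
  have hmD : AEMeasurable D μ := (hmap.fst).comp_aemeasurable hmY
  have hmM : AEMeasurable M μ := (hmap.snd).comp_aemeasurable hmY
  have hDM : IndepFun D M μ := indepFun_sub_sum hY hYi i₀
  have hDMW : IndepFun (fun ω => (D ω, M ω)) (fun ω j => W j ω) μ := hYW.comp hmap measurable_id
  have hindep := IndepFun.prodMk_right hmD hmM hmW hDM hDMW
  have hlaw := (indepFun_iff_map_prod_eq_prod_map_map hmD (hmM.prodMk hmW)).1 hindep
  set B : Set ((ι → E) × (E × (κ → E))) :=
    {q | ∀ j, (Fintype.card ι : ℝ)⁻¹ * inner ℝ (u q.1) q.2.1 < inner ℝ (u q.1) (q.2.2 j)} with hB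
  have hBm : MeasurableSet B := by
    simp only [hB, Set.ofPred_forall]
    refine MeasurableSet.iInter fun j => measurableSet_lt ?_ ?_
    · exact ((hum.comp measurable_fst).inner measurable_snd.fst).const_mul _
    · exact (hum.comp measurable_fst).inner ((measurable_pi_apply j).comp measurable_snd.snd)
  have hcard : (Fintype.card ι : ℝ) ≠ 0 := by positivity
  have hset : {ω | ∀ j, inner ℝ (u (D ω)) (Y i₀ ω) < inner ℝ (u (D ω)) (W j ω)} =
      (fun ω => (D ω, (M ω, fun j => W j ω))) ⁻¹' B := by
    ext ω
    -- the component of the mean along `u` is that of `Y i₀`, by orthogonality to the differences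
    have h1 : (Fintype.card ι : ℝ)⁻¹ * inner ℝ (u (D ω)) (M ω) = inner ℝ (u (D ω)) (Y i₀ ω) := by
      have h2 : M ω = ∑ i, D ω i + Fintype.card ι • Y i₀ ω := by
        simp [hM, hD, Finset.sum_sub_distrib]
      rw [h2, inner_add_right, inner_sum,
        Finset.sum_eq_zero fun i _ => hu (D ω) (by simp [hD]) i, ← Nat.cast_smul_eq_nsmul ℝ,
        real_inner_smul_right, zero_add, inv_mul_cancel_left₀ hcard]
    simp only [Set.mem_ofPred_eq, Set.mem_preimage, hB, h1]
  rw [hset, ← Measure.map_apply_of_aemeasurable (hmD.prodMk (hmM.prodMk hmW)) hBm, hlaw,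
    Measure.prod_apply hBm]
  have hae : ∀ᵐ δ ∂μ.map D, u δ ≠ 0 :=
    (ae_map_iff hmD (hum (measurableSet_singleton (0 : E)).compl)).2 hu0
  have := Measure.isProbabilityMeasure_map hmD
  rw [lintegral_congr_ae (g := fun _ => ENNReal.ofReal (∫ y, (1 - cdf (gaussianReal 0 1) y) ^
    Fintype.card κ ∂gaussianReal 0 (Fintype.card ι : NNReal)⁻¹))]
  · simp
  filter_upwards [hae] with δ hδ
  rw [Measure.map_apply_of_aemeasurable (hmM.prodMk hmW) (measurable_prodMk_left hBm)]
  exact measure_forall_mean_inner_lt hY hW hYi hWi hYW hδ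

end Facet

/-! ### The normal vector of the hyperplane through `d` points -/

section Normal

variable {d : ℕ}

/-- The generalized cross product of the vectors `δ i`, `i ≠ i₀`, in `ℝ^d`: the vector representing
the functional that sends `v` to the determinant with rows `δ i`, `i ≠ i₀`, and with `v` in row
`i₀`. The vector `δ i₀` is ignored; a row `i₀` is kept so that `d` points give a square matrix,
also for `d = 1`. -/
noncomputable def crossNormal (i₀ : Fin d) (δ : Fin d → EuclideanSpace ℝ (Fin d)) :
    EuclideanSpace ℝ (Fin d) :=
  WithLp.toLp 2 fun k =>
    ((Matrix.of fun i l => δ i l).updateRow i₀ (Pi.single k 1)).det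

theorem inner_crossNormal (i₀ : Fin d) (δ : Fin d → EuclideanSpace ℝ (Fin d))
    (v : EuclideanSpace ℝ (Fin d)) :
    inner ℝ (crossNormal i₀ δ) v = ((Matrix.of fun i l => δ i l).updateRow i₀ v).det := by
  set A : Matrix (Fin d) (Fin d) ℝ := Matrix.of fun i l => δ i l
  have h : (A.updateRow i₀ v).det = ∑ k, v k * (A.updateRow i₀ (Pi.single k 1)).det := by
    have h1 := (Matrix.detRowAlternating (R := ℝ) (n := Fin d)).toMultilinearMap.map_update_sum
      Finset.univ i₀ (fun k => v k • (Pi.single k 1 : Fin d → ℝ)) A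
    rw [← pi_eq_sum_univ' (v : Fin d → ℝ)] at h1
    refine h1.trans (Finset.sum_congr rfl fun k _ => ?_)
    exact (Matrix.detRowAlternating (R := ℝ) (n := Fin d)).toMultilinearMap.map_update_smul
      A i₀ (v k) _
  rw [h]
  simp [PiLp.inner_apply, crossNormal, A]

theorem measurable_crossNormal (i₀ : Fin d) : Measurable (crossNormal i₀) := by
  refine (Continuous.measurable ?_)
  refine (PiLp.continuous_toLp 2 _).comp (continuous_pi fun k => Continuous.matrix_det ?_)
  refine Continuous.matrix_updateRow _ ?_ continuous_const
  exact continuous_pi fun i => continuous_pi fun l => by fun_prop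

theorem inner_crossNormal_eq_zero {i₀ : Fin d} {δ : Fin d → EuclideanSpace ℝ (Fin d)}
    (h0 : δ i₀ = 0) (i : Fin d) : inner ℝ (crossNormal i₀ δ) (δ i) = 0 := by
  rw [inner_crossNormal]
  by_cases hi : i = i₀
  · subst hi
    rw [h0]
    exact Matrix.det_eq_zero_of_row_eq_zero i fun l => by simp
  · refine Matrix.det_zero_of_row_eq hi ?_
    rw [Matrix.updateRow_ne hi, Matrix.updateRow_self]
    rfl

/-- The differences of affinely independent points from the base point `y i₀` are linearly
independent. The difference of the additional point `z` is put in the place of `y i₀ - y i₀ = 0`,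
to match the rows of the determinant in `crossNormal`. -/
theorem linearIndependent_update_sub {ι E : Type*} [DecidableEq ι] [AddCommGroup E] [Module ℝ E]
    {y : ι → E} {z : E} (i₀ : ι)
    (h : AffineIndependent ℝ (fun o : Option ι => o.elim z y)) :
    LinearIndependent ℝ (Function.update (fun i => y i - y i₀) i₀ (z - y i₀)) := by
  rw [affineIndependent_iff_linearIndependent_vsub ℝ _ (some i₀)] at h
  let g : ι → {o : Option ι // o ≠ some i₀} := fun i =>
    if hi : i = i₀ then ⟨none, by simp⟩ else ⟨some i, by simpa using hi⟩
  have hg : Function.Injective g := by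
    intro i j hij
    by_cases hi : i = i₀ <;> by_cases hj : j = i₀ <;> simp_all [g]
  have heq : Function.update (fun i => y i - y i₀) i₀ (z - y i₀) =
      (fun o : {o : Option ι // o ≠ some i₀} => o.1.elim z y -ᵥ (some i₀).elim z y) ∘ g := by
    funext i
    by_cases hi : i = i₀
    · subst hi; simp [g]
    · simp [g, hi]
  rw [heq]
  exact h.comp g hg

/-- Of `d + 1` affinely independent points in `ℝ^d`, the last one is off the hyperplane through the
others. -/
theorem inner_crossNormal_ne_zero {y : Fin d → EuclideanSpace ℝ (Fin d)}
    {z : EuclideanSpace ℝ (Fin d)} (i₀ : Fin d)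
    (h : AffineIndependent ℝ (fun o : Option (Fin d) => o.elim z y)) :
    inner ℝ (crossNormal i₀ fun i => y i - y i₀) (z - y i₀) ≠ 0 := by
  rw [inner_crossNormal]
  have h1 := (linearIndependent_update_sub i₀ h).map'
    (WithLp.linearEquiv 2 ℝ (Fin d → ℝ)).toLinearMap (LinearEquiv.ker _)
  set A := (Matrix.of fun i l => (y i - y i₀) l).updateRow i₀ (z - y i₀) with hA
  have hrow : A.row = (WithLp.linearEquiv 2 ℝ (Fin d → ℝ)).toLinearMap ∘
      Function.update (fun i => y i - y i₀) i₀ (z - y i₀) := by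
    funext i
    by_cases hi : i = i₀
    · subst hi; ext l; simp [hA, Matrix.row]
    · ext l; simp [hA, hi, Matrix.row]
  have h2 : LinearIndependent ℝ A.row := by rw [hrow]; exact h1
  rw [Matrix.linearIndependent_rows_iff_isUnit, Matrix.isUnit_iff_isUnit_det] at h2
  exact h2.ne_zero

/-- In general position, `d` of the points form a facet exactly if all others lie strictly on one
side of the hyperplane through them. -/
theorem isFacetSet_iff {x : ℕ → EuclideanSpace ℝ (Fin d)} {n : ℕ} {S : Finset ℕ} {e : Fin d → ℕ}
    (he : ∀ i, i ∈ S ↔ ∃ k, e k = i) (i₀ : Fin d)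
    (hgen : ∀ j ∈ Finset.range n \ S,
      AffineIndependent ℝ (fun o : Option (Fin d) => o.elim (x j) (fun i => x (e i)))) :
    IsFacetSet x n S ↔
      (∀ j ∈ Finset.range n \ S,
        inner ℝ (crossNormal i₀ fun i => x (e i) - x (e i₀)) (x (e i₀)) <
          inner ℝ (crossNormal i₀ fun i => x (e i) - x (e i₀)) (x j)) ∨
      ∀ j ∈ Finset.range n \ S,
        inner ℝ (crossNormal i₀ fun i => x (e i) - x (e i₀)) (x j) <
          inner ℝ (crossNormal i₀ fun i => x (e i) - x (e i₀)) (x (e i₀)) := by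
  set u := crossNormal i₀ fun i => x (e i) - x (e i₀) with hu
  have hperp (k : Fin d) : inner ℝ u (x (e k)) = inner ℝ u (x (e i₀)) := by
    have := inner_crossNormal_eq_zero (i₀ := i₀) (δ := fun i => x (e i) - x (e i₀)) (by simp) k
    rwa [inner_sub_right, sub_eq_zero] at this
  constructor
  · rintro ⟨l, c, hl, hl'⟩
    rcases (Finset.range n \ S).eq_empty_or_nonempty with hT | ⟨j₀, hj₀⟩
    · left; simp [hT]
    have hl0 (k : Fin d) : l (x (e k)) = c := hl _ ((he _).2 ⟨k, rfl⟩)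
    have hneg : ∀ j ∈ Finset.range n \ S, l (x j - x (e i₀)) < 0 := fun j hj => by
      rw [map_sub, hl0, sub_neg]; exact hl' j hj
    -- both functionals vanish on the differences, so they are proportional
    have hprop (w : EuclideanSpace ℝ (Fin d)) : l (x j₀ - x (e i₀)) * inner ℝ u w =
        inner ℝ u (x j₀ - x (e i₀)) * l w := by
      have hli := linearIndependent_update_sub i₀ (hgen j₀ hj₀)
      have hspan := hli.span_eq_top_of_card_eq_finrank' (by simp)
      have hext : (l (x j₀ - x (e i₀)) • innerSL ℝ u).toLinearMap =
          (inner ℝ u (x j₀ - x (e i₀)) • l).toLinearMap := by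
        refine LinearMap.ext_on_range hspan fun i => ?_
        by_cases hi : i = i₀
        · subst hi; simp [mul_comm]
        · simp [hi, hl0, inner_sub_right, hperp i]
      simpa using congrArg (fun f => f w) hext
    have h0 := inner_crossNormal_ne_zero i₀ (hgen j₀ hj₀)
    rw [← hu] at h0
    have hj₀l := hneg j₀ hj₀
    rcases lt_or_gt_of_ne h0 with h0 | h0
    · right
      intro j hj
      have h1 := hprop (x j - x (e i₀))
      have h2 := hneg j hj
      rw [← sub_neg, ← inner_sub_right]
      by_contra hcon
      nlinarith [mul_pos_of_neg_of_neg h0 h2, mul_nonneg (neg_nonneg.2 hj₀l.le) (not_lt.1 hcon)]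
    · left
      intro j hj
      have h1 := hprop (x j - x (e i₀))
      have h2 := hneg j hj
      rw [← sub_pos, ← inner_sub_right]
      by_contra hcon
      nlinarith [mul_pos h0 (neg_pos.2 h2),
        mul_nonneg (neg_nonneg.2 hj₀l.le) (neg_nonneg.2 (not_lt.1 hcon))]
  · rintro (h | h)
    · refine ⟨-innerSL ℝ u, -inner ℝ u (x (e i₀)), fun i hi => ?_, fun j hj => ?_⟩
      · obtain ⟨k, rfl⟩ := (he i).1 hi
        simpa using hperp k
      · simpa using h j hj
    · refine ⟨innerSL ℝ u, inner ℝ u (x (e i₀)), fun i hi => ?_, fun j hj => ?_⟩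
      · obtain ⟨k, rfl⟩ := (he i).1 hi
        simpa using hperp k
      · simpa using h j hj

end Normal

/-! ### The expected number of facets -/

section Expectation

variable {d : ℕ} {Ω : Type*} [MeasurableSpace Ω] {μ : Measure Ω} [IsProbabilityMeasure μ]
  {X : ℕ → Ω → EuclideanSpace ℝ (Fin d)}

/-- Given `d` of the points, all others lie on the same side of the hyperplane through them with
probability `2 * 𝔼[(1 - Φ(h)) ^ (n - d)]`, where `h ~ N(0, 1 / d)`: the two sides are exchanged by
reversing the normal vector, so each contributes the same. -/
theorem nullMeasurableSet_and_measureReal_isFacetSet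
    (hX : ∀ i, HasLaw (X i) (stdGaussian (EuclideanSpace ℝ (Fin d))) μ) (hindep : iIndepFun X μ)
    (hd : 1 ≤ d) {n : ℕ} (hn : d < n) {S : Finset ℕ} (hSn : S ⊆ Finset.range n)
    (hS : S.card = d) :
    NullMeasurableSet {ω | IsFacetSet (fun i => X i ω) n S} μ ∧
      μ.real {ω | IsFacetSet (fun i => X i ω) n S} =
        2 * ∫ y, (1 - cdf (gaussianReal 0 1) y) ^ (n - d) ∂gaussianReal 0 (d : NNReal)⁻¹ := by
  classical
  set T := Finset.range n \ S with hT
  have hTcard : T.card = n - d := by rw [hT, Finset.card_sdiff_of_subset hSn, hS, Finset.card_range]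
  set e : Fin d → ℕ := ⇑(S.orderEmbOfFin hS) with he
  have heS (i : Fin d) : e i ∈ S := Finset.orderEmbOfFin_mem S hS i
  have heinj : Function.Injective e := (S.orderEmbOfFin hS).injective
  have hmem (i : ℕ) : i ∈ S ↔ ∃ k, e k = i := by
    change i ∈ S ↔ i ∈ Set.range e
    rw [he, Finset.range_orderEmbOfFin, Finset.mem_coe]
  let i₀ : Fin d := ⟨0, hd⟩
  have hmeas : ∀ i, AEMeasurable (X i) μ := fun i => (hX i).aemeasurable
  have hmD : AEMeasurable (fun ω i => X (e i) ω - X (e i₀) ω) μ :=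
    aemeasurable_pi_lambda _ fun i => (hmeas _).sub (hmeas _)
  have hYW : IndepFun (fun ω i => X (e i) ω) (fun ω (j : T) => X j ω) μ :=
    (hindep.indepFun_finset₀ S T Finset.disjoint_sdiff hmeas).comp
      (φ := fun (y : S → EuclideanSpace ℝ (Fin d)) i => y ⟨e i, heS i⟩) (by fun_prop)
      measurable_id
  have hgen : ∀ᵐ ω ∂μ, ∀ j ∈ T,
      AffineIndependent ℝ (fun o : Option (Fin d) => o.elim (X j ω) (fun i => X (e i) ω)) := by
    rw [Finset.eventually_all]
    intro j hj
    have hjS : j ∉ S := (Finset.mem_sdiff.1 hj).2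
    have hcard : (insert j S).card ≤ Module.finrank ℝ (EuclideanSpace ℝ (Fin d)) + 1 := by
      simp [Finset.card_insert_of_notMem hjS, hS]
    filter_upwards [ae_affineIndependent hX hindep (insert j S) hcard] with ω hω
    let g : Option (Fin d) → (insert j S : Finset ℕ) := fun o =>
      o.elim ⟨j, by simp⟩ fun i => ⟨e i, Finset.mem_insert_of_mem (heS i)⟩
    have hg : Function.Injective g := by
      have hne (i : Fin d) : e i ≠ j := fun h => hjS (h ▸ heS i)
      rintro (_ | i) (_ | k) h
      · rfl
      · exact absurd (congrArg Subtype.val h).symm (hne k)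
      · exact absurd (congrArg Subtype.val h) (hne i)
      · have hik : (g (some i) : ℕ) = g (some k) := by rw [h]
        exact congrArg some (heinj hik)
    have := hω.comp_embedding ⟨g, hg⟩
    refine (congrArg (AffineIndependent ℝ) ?_).mpr this
    funext o
    rcases o with _ | i <;> rfl
  obtain ⟨j₀, hj₀⟩ : T.Nonempty := Finset.card_pos.1 (by omega)
  have hu0 : ∀ᵐ ω ∂μ, crossNormal i₀ (fun i => X (e i) ω - X (e i₀) ω) ≠ 0 := by
    filter_upwards [hgen] with ω hω h
    have := inner_crossNormal_ne_zero i₀ (hω j₀ hj₀)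
    rw [h, inner_zero_left] at this
    exact this rfl
  -- applied to the normal vector and to its negative, this covers both sides of the hyperplane
  have key {u : (Fin d → EuclideanSpace ℝ (Fin d)) → EuclideanSpace ℝ (Fin d)}
      (hum : Measurable u) (hu : ∀ δ, δ i₀ = 0 → ∀ i, inner ℝ (u δ) (δ i) = 0)
      (hu0 : ∀ᵐ ω ∂μ, u (fun i => X (e i) ω - X (e i₀) ω) ≠ 0) :
      NullMeasurableSet {ω | ∀ j : T, inner ℝ (u fun i => X (e i) ω - X (e i₀) ω) (X (e i₀) ω) <
        inner ℝ (u fun i => X (e i) ω - X (e i₀) ω) (X j ω)} μ ∧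
      μ.real {ω | ∀ j : T, inner ℝ (u fun i => X (e i) ω - X (e i₀) ω) (X (e i₀) ω) <
        inner ℝ (u fun i => X (e i) ω - X (e i₀) ω) (X j ω)} =
        ∫ y, (1 - cdf (gaussianReal 0 1) y) ^ (n - d) ∂gaussianReal 0 (d : NNReal)⁻¹ := by
    constructor
    · simp only [Set.ofPred_forall]
      exact NullMeasurableSet.iInter fun j => nullMeasurableSet_lt
        ((hum.comp_aemeasurable hmD).inner (hmeas _)) ((hum.comp_aemeasurable hmD).inner (hmeas _))
    · have h := measure_forall_inner_lt (Y := fun i => X (e i)) (W := fun j : T => X j)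
        (fun i => hX _) (fun j => hX _)
        (hindep.precomp heinj) (hindep.precomp Subtype.val_injective) hYW i₀ hum hu hu0
      rw [measureReal_def, h, ENNReal.toReal_ofReal]
      · simp [hTcard]
      · exact integral_nonneg fun y =>
          pow_nonneg (by linarith [cdf_le_one (gaussianReal 0 1) y]) _
  obtain ⟨hm1, hp1⟩ := key (measurable_crossNormal i₀)
    (fun δ h0 i => inner_crossNormal_eq_zero h0 i) hu0
  obtain ⟨hm2, hp2⟩ := key (u := fun δ => -crossNormal i₀ δ) (measurable_crossNormal i₀).neg
    (fun δ h0 i => by rw [inner_neg_left, inner_crossNormal_eq_zero h0 i, neg_zero])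
    (hu0.mono fun ω h => neg_ne_zero.2 h)
  set A₁ := {ω | ∀ j : T, inner ℝ (crossNormal i₀ fun i => X (e i) ω - X (e i₀) ω) (X (e i₀) ω) <
        inner ℝ (crossNormal i₀ fun i => X (e i) ω - X (e i₀) ω) (X j ω)} with hA₁
  set A₂ := {ω | ∀ j : T, inner ℝ (-crossNormal i₀ fun i => X (e i) ω - X (e i₀) ω) (X (e i₀) ω) <
        inner ℝ (-crossNormal i₀ fun i => X (e i) ω - X (e i₀) ω) (X j ω)} with hA₂
  have hae : {ω | IsFacetSet (fun i => X i ω) n S} =ᵐ[μ] (A₁ ∪ A₂ : Set Ω) := by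
    filter_upwards [hgen] with ω hω
    have := isFacetSet_iff (x := fun i => X i ω) hmem i₀ hω
    refine propext (this.trans ?_)
    change _ ↔ ω ∈ A₁ ∪ A₂
    simp [hA₁, hA₂, inner_neg_left, hT]
  have hdisj : Disjoint A₁ A₂ := by
    rw [Set.disjoint_left]
    intro ω h1 h2
    have h1' := h1 ⟨j₀, hj₀⟩
    have h2' := h2 ⟨j₀, hj₀⟩
    simp only [inner_neg_left] at h2'
    linarith
  refine ⟨(hm1.union hm2).congr hae.symm, ?_⟩
  rw [measureReal_congr hae, measureReal_union₀ hm2 hdisj.aedisjoint, hp1, hp2]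
  ring

open Classical in
/-- This holds for every `n`, including `n ≤ d`, where the hull has empty interior. -/
theorem ae_faceNumber_eq_card
    (hX : ∀ i, HasLaw (X i) (stdGaussian (EuclideanSpace ℝ (Fin d))) μ) (hindep : iIndepFun X μ)
    (hd : 1 ≤ d) (n : ℕ) :
    ∀ᵐ ω ∂μ, faceNumber (d - 1) (pointHull (fun i => X i ω) n) =
      (((Finset.range n).powersetCard d).filter (IsFacetSet (fun i => X i ω) n)).card := by
  have h : ∀ᵐ ω ∂μ, ∀ S ∈ (Finset.range n).powerset, S.card ≤ d + 1 →
      AffineIndependent ℝ (fun i : S => X i ω) := by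
    rw [Finset.eventually_all]
    intro S _
    by_cases hS : S.card ≤ d + 1
    · filter_upwards [ae_affineIndependent hX hindep S (by simpa using hS)] with ω hω _ using hω
    · exact ae_of_all _ fun ω h => absurd h hS
  filter_upwards [h] with ω hω
  have := faceNumber_pointHull_eq_card (x := fun i => X i ω) (n := n) (k := d - 1)
    fun S hS hc => hω S (Finset.mem_powerset.2 hS) (by omega)
  rwa [Nat.sub_add_cancel hd] at this

theorem integrable_and_integral_faceNumber
    (hX : ∀ i, HasLaw (X i) (stdGaussian (EuclideanSpace ℝ (Fin d))) μ) (hindep : iIndepFun X μ)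
    (hd : 1 ≤ d) {n : ℕ} (hn : d < n) :
    Integrable (fun ω => (faceNumber (d - 1) (pointHull (fun i => X i ω) n) : ℝ)) μ ∧
    ∫ ω, (faceNumber (d - 1) (pointHull (fun i => X i ω) n) : ℝ) ∂μ =
      2 * (n.choose d * ∫ y, (1 - cdf (gaussianReal 0 1) y) ^ (n - d)
        ∂gaussianReal 0 (d : NNReal)⁻¹) := by
  classical
  have hS (S : Finset ℕ) (h : S ∈ (Finset.range n).powersetCard d) :=
    nullMeasurableSet_and_measureReal_isFacetSet hX hindep hd hn
      (Finset.mem_powersetCard.1 h).1 (Finset.mem_powersetCard.1 h).2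
  have hae : (fun ω => (faceNumber (d - 1) (pointHull (fun i => X i ω) n) : ℝ)) =ᵐ[μ]
      fun ω => ∑ S ∈ (Finset.range n).powersetCard d,
        {ω | IsFacetSet (fun i => X i ω) n S}.indicator (fun _ => (1 : ℝ)) ω := by
    filter_upwards [ae_faceNumber_eq_card hX hindep hd n] with ω hω
    rw [hω, Finset.card_filter]
    push_cast
    refine Finset.sum_congr rfl fun S _ => ?_
    simp [Set.indicator_apply]
  have hint (S : Finset ℕ) (h : S ∈ (Finset.range n).powersetCard d) :
      Integrable ({ω | IsFacetSet (fun i => X i ω) n S}.indicator fun _ => (1 : ℝ)) μ :=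
    (integrable_const (1 : ℝ)).indicator₀ (hS S h).1
  refine ⟨(integrable_finsetSum _ hint).congr hae.symm, ?_⟩
  rw [integral_congr_ae hae, integral_finsetSum _ hint, Finset.sum_congr rfl fun S h => by
    rw [integral_indicator₀ (hS S h).1, setIntegral_const, smul_eq_mul, mul_one, (hS S h).2]]
  rw [Finset.sum_const, Finset.card_powersetCard, Finset.card_range, nsmul_eq_mul]
  ring

theorem ae_faceNumber_eq_zero
    (hX : ∀ i, HasLaw (X i) (stdGaussian (EuclideanSpace ℝ (Fin d))) μ) (hindep : iIndepFun X μ)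
    (hd : 1 ≤ d) {n : ℕ} (hn : n < d) :
    (fun ω => (faceNumber (d - 1) (pointHull (fun i => X i ω) n) : ℝ)) =ᵐ[μ] fun _ => 0 := by
  classical
  filter_upwards [ae_faceNumber_eq_card hX hindep hd n] with ω hω
  rw [hω, Finset.powersetCard_eq_empty.2 (by simpa using hn)]
  simp

/-- The hull of exactly `d` points is a simplex of dimension `d - 1`, its own only facet. -/
theorem ae_faceNumber_eq_one
    (hX : ∀ i, HasLaw (X i) (stdGaussian (EuclideanSpace ℝ (Fin d))) μ) (hindep : iIndepFun X μ)
    (hd : 1 ≤ d) :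
    (fun ω => (faceNumber (d - 1) (pointHull (fun i => X i ω) d) : ℝ)) =ᵐ[μ] fun _ => 1 := by
  classical
  filter_upwards [ae_faceNumber_eq_card hX hindep hd d] with ω hω
  have hself : (Finset.range d).powersetCard d = {Finset.range d} := by
    simpa using Finset.powersetCard_self (Finset.range d)
  -- the zero functional exposes the whole simplex
  have hfacet : IsFacetSet (fun i => X i ω) d (Finset.range d) :=
    ⟨0, 0, by simp, by simp⟩
  rw [hω, hself, Finset.filter_singleton, if_pos hfacet]
  simp

end Expectation

theorem mainTheorem1 (d : ℕ) (hd : 1 ≤ d)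
    {Ω : Type*} [MeasurableSpace Ω] (μ : Measure Ω) [IsProbabilityMeasure μ]
    (X : ℕ → Ω → EuclideanSpace ℝ (Fin d))
    (hX : ∀ i, HasLaw (X i) (stdGaussian (EuclideanSpace ℝ (Fin d))) μ)
    (hindep : iIndepFun X μ) :
    (∀ n : ℕ, Integrable
      (fun ω => (faceNumber (d - 1) (pointHull (fun i => X i ω) n) : ℝ)) μ) ∧
    Monotone (fun n : ℕ =>
      ∫ ω, (faceNumber (d - 1) (pointHull (fun i => X i ω) n) : ℝ) ∂μ) := by
  constructor
  · intro n
    rcases lt_trichotomy n d with hn | rfl | hn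
    · exact (integrable_const _).congr (ae_faceNumber_eq_zero hX hindep hd hn).symm
    · exact (integrable_const _).congr (ae_faceNumber_eq_one hX hindep hd).symm
    · exact (integrable_and_integral_faceNumber hX hindep hd hn).1
  · refine monotone_nat_of_le_succ fun n => ?_
    rcases lt_trichotomy n d with hn | rfl | hn
    · rw [integral_congr_ae (ae_faceNumber_eq_zero hX hindep hd hn), integral_zero]
      exact integral_nonneg fun ω => Nat.cast_nonneg _
    · rw [integral_congr_ae (ae_faceNumber_eq_one hX hindep hd),
        (integrable_and_integral_faceNumber hX hindep hd n.lt_add_one).2]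
      -- the formula for `n > d` gives `2` at `n = d`, where the hull has only one facet
      have h := choose_mul_integral_one_sub_cdf_pow_le 0 hd
      simp only [zero_add, Nat.choose_self, pow_zero, integral_const, probReal_univ, smul_eq_mul,
        Nat.cast_one, one_mul] at h
      rw [Nat.add_comm n 1, Nat.add_sub_cancel]
      simp only [integral_const, probReal_univ, smul_eq_mul, one_mul]
      linarith
    · rw [(integrable_and_integral_faceNumber hX hindep hd hn).2,
        (integrable_and_integral_faceNumber hX hindep hd (hn.trans n.lt_add_one)).2]
      obtain ⟨m, rfl⟩ := Nat.exists_eq_add_of_lt hn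
      have h := choose_mul_integral_one_sub_cdf_pow_le (m + 1) hd
      rw [show d + m + 1 = m + 1 + d by ring, show m + 1 + d + 1 = m + 1 + 1 + d by ring,
        Nat.add_sub_cancel, Nat.add_sub_cancel]
      linarith
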